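/- Let $G$ be a Polish group, i.e. a topological group whose topology is separable and completely metrizable. Let $E(G)$ be the equivalence relation on $G^\omega$ given by $$x\,E(G)\,y\iff \text{the sequence } x(n)y(n)^{-1}\text{ converges in } G .$$ For equivalence relations $E,F$ on Polish spaces $X,Y$, write $E\le_B F$ if there is a Borel map $\theta:X\to Y$ such that $x\,E\,y\iff\theta(x)\,F\,\theta(y)$ for all $x,y\in X$, and write $E\sim_B F$ if $E\le_B F$ and $F\le_B E$. Let $E_0$ be the relation on $2^\omega$ given by $x\,E_0\,y\iff\exists m\,\forall n>m\;x(n)=y(n)$, let $E_0^\omega$ be the relation on $(2^\omega)^\omega$ given by $(x_n)\,E_0^\omega\,(y_n)\iff\forall n\;x_n\,E_0\,y_n$, and let $=^+$ be the relation on $(\omega^\omega)^\omega$ given by $(x_n)=^+(y_n)\iff\{x_n:n\in\omega\}=\{y_n:n\in\omega\}$. Call $G$ TSI if it admits a compatible metric that is both left and right invariant, and non-archimedean if the identity has a neighborhood base consisting of open subgroups. Then: 1. $G$ is countable and discrete with at least two elements if and only if $E(G)\sim_B E_0$. 2. If $G$ is TSI, uncountable and non-archimedean, then $E(G)\sim_B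 E_0^\omega$. 3. $G$ is non-archimedean if and only if $E(G)\le_B\, =^+$. 4. If $G$ is uncountable, then $E_0^\omega\le_B E(G)$. -/

import Mathlib

open Filter Topology

namespace PolishER

/-- A Borel reduction of `E` to `F`: a Borel map `θ` with `x E y ↔ θ x F θ y`;
here `E ≤_B F` says that one exists. -/
def BorelReducible {X Y : Type*} [TopologicalSpace X] [TopologicalSpace Y]
    (E : Setoid X) (F : Setoid Y) : Prop :=
  ∃ θ : X → Y, @Measurable X Y (borel X) (borel Y) θ ∧ ∀ x y : X, E x y ↔ F (θ x) (θ y)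

/-- `E ∼_B F`: each of the two is Borel reducible to the other. -/
def BorelBireducible {X Y : Type*} [TopologicalSpace X] [TopologicalSpace Y]
    (E : Setoid X) (F : Setoid Y) : Prop :=
  BorelReducible E F ∧ BorelReducible F E

/-- Eventual equality `E_0` on the Cantor space `2^ω`. -/
def eZero : Setoid (ℕ → Bool) where
  r x y := ∃ m, ∀ n > m, x n = y n
  iseqv :=
    { refl := fun _ => ⟨0, fun _ _ => rfl⟩
      symm := fun ⟨m, h⟩ => ⟨m, fun n hn => (h n hn).symm⟩
      trans := fun ⟨m, h⟩ ⟨k, h2⟩ => ⟨max m k, fun n hn =>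
        (h n (lt_of_le_of_lt (le_max_left m k) hn)).trans
          (h2 n (lt_of_le_of_lt (le_max_right m k) hn))⟩ }

/-- The countable power `E^ω` on `X^ω`. -/
def omegaPower {X : Type*} (E : Setoid X) : Setoid (ℕ → X) where
  r x y := ∀ n, E (x n) (y n)
  iseqv :=
    { refl := fun x n => E.refl (x n)
      symm := fun h n => E.symm (h n)
      trans := fun h h2 n => E.trans (h n) (h2 n) }

/-- The jump `E^+` on `X^ω`: the two sequences enumerate the same set of `E`-classes. -/
def jump {X : Type*} (E : Setoid X) : Setoid (ℕ → X) where
  r x y := (∀ n, ∃ m, E (x n) (y m)) ∧ (∀ m, ∃ n, E (x n) (y m))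
  iseqv :=
    { refl := fun x => ⟨fun n => ⟨n, E.refl (x n)⟩, fun n => ⟨n, E.refl (x n)⟩⟩
      symm := fun ⟨h, k⟩ =>
        ⟨fun n => (k n).imp fun _ => E.symm, fun n => (h n).imp fun _ => E.symm⟩
      trans := fun ⟨h, k⟩ ⟨h2, k2⟩ =>
        ⟨fun n => by
          obtain ⟨m, hm⟩ := h n
          obtain ⟨l, hl⟩ := h2 m
          exact ⟨l, E.trans hm hl⟩,
        fun n => by
          obtain ⟨m, hm⟩ := k2 n
          obtain ⟨l, hl⟩ := k m
          exact ⟨l, E.trans hl hm⟩⟩ }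

/-- The relation `=^+`: the jump of equality (`⊥` in the lattice of equivalence relations)
on the Baire space `ω^ω`. -/
def eqPlus : Setoid (ℕ → ℕ → ℕ) := jump (⊥ : Setoid (ℕ → ℕ))

/-- The equivalence relation `E(G)` on `G^ω`: `x E(G) y` iff the sequence
`x(n) y(n)⁻¹` converges in `G`. -/
def inducedER (G : Type*) [Group G] [TopologicalSpace G] [IsTopologicalGroup G] :
    Setoid (ℕ → G) where
  r x y := ∃ g : G, Tendsto (fun n => x n * (y n)⁻¹) atTop (𝓝 g)
  iseqv :=
    { refl := fun x => ⟨1, by simpa using tendsto_const_nhds⟩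
      symm := fun ⟨g, h⟩ => ⟨g⁻¹, by simpa using h.inv⟩
      trans := fun ⟨g, h⟩ ⟨k, h2⟩ => ⟨g * k, by simpa [mul_assoc] using h.mul h2⟩ }

/-- A topological group is TSI if its topology is given by some two sided invariant metric. -/
def IsTSI (G : Type*) [Group G] [t : TopologicalSpace G] : Prop :=
  ∃ d : MetricSpace G, d.toUniformSpace.toTopologicalSpace = t ∧
    (∀ g h k : G, d.dist (g * h) (g * k) = d.dist h k) ∧
    (∀ g h k : G, d.dist (h * g) (k * g) = d.dist h k)

end PolishER

/-!
# Equivalence relations induced by Polish groups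

**Lower bounds.** Interleaving a sequence with `1`s (`interleaveOne`) turns convergence of the
quotients into convergence to `1`. If `g_k → 1` with `g_k ≠ 1`, the sequence whose `⟨k, i⟩`-th entry
is `g_k` or `1` according to the bit `x_k(i)` then reduces `E_0^ω` to `E(G)`, and such `g_k` exist
when `G` is uncountable.

**Upper bounds.** If `G` is countable and discrete, `x_n y_n⁻¹` is eventually constant iff
`x_n⁻¹ x_{n+1}` and `y_n⁻¹ y_{n+1}` eventually agree; with open normal subgroups as a basis at `1` the
same holds modulo each of them. For general open subgroups `V_k`, the class of `x` is determined by
the countable set of sequences eventually equal to some `n ↦ V_k g x_n`. These invariants only show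
that the quotients form a sequence that is Cauchy on one side or on both;
`exists_tendsto_of_left_right_cauchy`, two-sided completeness of Polish groups, supplies the limit.

**Non-reducibility.** Both negative results rest on one Baire category argument. Let `A` be an
abelian Polish group and let `a : ℕ → A` enumerate generators of a dense subgroup, with `a 0 = 0`.
Suppose that `f x` is always one of countably many values `g_j (x + δ)`, whenever the perturbation
`δ ∈ A^ω` has all its entries in the range of `a`. By Baire, `f x = g_j (x + δ)` generically on an open
box, for one `j`. Moving an entry from `δ` to `x` shows that `f` is generically invariant there under
single perturbations at late places, and a zero-one law gives invariance under generic changes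
of a whole tail (`exists_open_eventually_eq_add_tailFrom`).

* For `A = ℤ^ω` and `a` running through the unit vectors, the perturbations preserve the
  `E_0^ω`-class of the parities of a point of `A^ω`.
  Countability of `E_0`-classes then makes a reduction of `E_0^ω` to `E_0` invariant under changes
  that do not preserve the class (`not_omegaPower_eZero_reducible_eZero`).
* If `G` is not non-archimedean, then arbitrarily short steps lead from `1` out of a fixed
  neighbourhood. Let `A = ℤ` with `a` taking the values `0` and `1`, and let `x ∈ ℤ^ω` choose a point
  on each of a sequence of such paths with steps tending to `1`. Perturbations preserve the
  `E(G)`-class, so a reduction to `=^+` would assign the same set to generic pairs of points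
  (`eventually_range_eq_range_add`); but generic pairs are inequivalent, since infinitely often one
  point is at the start and the other at the end of the path.
-/

open Filter Topology

namespace PolishER

/-! ### Reductions between the benchmark relations and `E(G)` -/

section Reductions

theorem BorelReducible.trans {X Y Z : Type*} [TopologicalSpace X] [TopologicalSpace Y]
    [TopologicalSpace Z] {E : Setoid X} {F : Setoid Y} {R : Setoid Z}
    (h : BorelReducible E F) (k : BorelReducible F R) : BorelReducible E R := by
  obtain ⟨θ, hθ, hE⟩ := h
  obtain ⟨ψ, hψ, hF⟩ := k
  exact ⟨ψ ∘ θ, @Measurable.comp _ _ _ (borel X) (borel Y) (borel Z) _ _ hψ hθ,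
    fun x y => (hE x y).trans (hF _ _)⟩

theorem BorelReducible.of_continuous {X Y : Type*} [TopologicalSpace X] [TopologicalSpace Y]
    {E : Setoid X} {F : Setoid Y} (θ : X → Y) (hθ : Continuous θ)
    (h : ∀ x y, E x y ↔ F (θ x) (θ y)) : BorelReducible E F :=
  ⟨θ, hθ.borel_measurable, h⟩

theorem eZero_iff {x y : ℕ → Bool} : eZero x y ↔ ∀ᶠ n in atTop, x n = y n := by
  change (∃ m, ∀ n > m, x n = y n) ↔ _
  rw [eventually_atTop]
  constructor
  · rintro ⟨m, h⟩
    exact ⟨m + 1, fun n hn => h n hn⟩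
  · rintro ⟨m, h⟩
    exact ⟨m, fun n hn => h n hn.le⟩

theorem omegaPower_iff {X : Type*} {E : Setoid X} {x y : ℕ → X} :
    omegaPower E x y ↔ ∀ n, E (x n) (y n) := Iff.rfl

theorem eqPlus_iff {x y : ℕ → ℕ → ℕ} :
    eqPlus x y ↔ Set.range x = Set.range y := by
  change ((∀ n, ∃ m, x n = y m) ∧ (∀ m, ∃ n, x n = y m)) ↔ _
  rw [Set.Subset.antisymm_iff, Set.range_subset_iff, Set.range_subset_iff]
  simp only [Set.mem_range, eq_comm]

/-- The code in `2^ω` of the graph of a function `ω → ω`. -/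
def graphCode (s : ℕ → ℕ) (n : ℕ) : Bool := decide (s n.unpair.1 = n.unpair.2)

/-- Graphs of functions differ in finitely many points iff the functions do. -/
theorem eZero_graphCode_iff {s t : ℕ → ℕ} :
    eZero (graphCode s) (graphCode t) ↔ ∀ᶠ n in atTop, s n = t n := by
  rw [eZero_iff]
  constructor
  · intro h
    obtain ⟨N, hN⟩ := eventually_atTop.1 h
    refine eventually_atTop.2 ⟨N, fun n hn => ?_⟩
    have := hN (Nat.pair n (s n)) (hn.trans (Nat.left_le_pair _ _))
    simp only [graphCode, Nat.unpair_pair, decide_true] at this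
    exact (of_decide_eq_true this.symm).symm
  · intro h
    obtain ⟨N, hN⟩ := eventually_atTop.1 h
    -- A point where the graphs differ has the form `(n, s n)` or `(n, t n)` with `n < N`.
    have hfin : ((Finset.range N).image (fun n => Nat.pair n (s n)) ∪
        (Finset.range N).image (fun n => Nat.pair n (t n)) : Set ℕ).Finite := by
      exact ((Finset.finite_toSet _).union (Finset.finite_toSet _))
    rw [← Nat.cofinite_eq_atTop]
    filter_upwards [hfin.compl_mem_cofinite] with m hm
    by_cases hlt : m.unpair.1 < N
    · have h1 : s m.unpair.1 ≠ m.unpair.2 := fun e => hm <| Or.inl <| by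
        simp only [Finset.coe_image, Set.mem_image, Finset.mem_coe, Finset.mem_range]
        exact ⟨_, hlt, by rw [e, Nat.pair_unpair]⟩
      have h2 : t m.unpair.1 ≠ m.unpair.2 := fun e => hm <| Or.inr <| by
        simp only [Finset.coe_image, Set.mem_image, Finset.mem_coe, Finset.mem_range]
        exact ⟨_, hlt, by rw [e, Nat.pair_unpair]⟩
      simp [graphCode, h1, h2]
    · simp [graphCode, hN _ (not_lt.1 hlt)]

end Reductions

section Interleave

variable {G : Type*} [Group G] [TopologicalSpace G] [IsTopologicalGroup G]

theorem inducedER_iff {x y : ℕ → G} :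
    inducedER G x y ↔ ∃ g : G, Tendsto (fun n => x n * (y n)⁻¹) atTop (𝓝 g) := Iff.rfl

/-- The sequence `u(0), 1, u(1), 1, …`. -/
def interleaveOne (u : ℕ → G) (n : ℕ) : G := if Even n then u (n / 2) else 1

omit [IsTopologicalGroup G] in
theorem continuous_interleaveOne : Continuous (interleaveOne (G := G)) := by
  refine continuous_pi fun n => ?_
  unfold interleaveOne
  split_ifs <;> fun_prop

/-- The interspersed `1`s force the limit of the quotients to be `1`. -/
theorem inducedER_interleaveOne_iff [T2Space G] {u v : ℕ → G} :
    inducedER G (interleaveOne u) (interleaveOne v) ↔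
      Tendsto (fun n => u n * (v n)⁻¹) atTop (𝓝 1) := by
  rw [inducedER_iff]
  constructor
  · rintro ⟨g, hg⟩
    have heven : Tendsto (fun n : ℕ => 2 * n) atTop atTop :=
      tendsto_atTop_mono (fun n => show n ≤ 2 * n by omega) tendsto_id
    have hodd : Tendsto (fun n : ℕ => 2 * n + 1) atTop atTop :=
      tendsto_atTop_mono (fun n => show n ≤ 2 * n + 1 by omega) tendsto_id
    have h1 := hg.comp hodd
    have h2 := hg.comp heven
    have hg1 : g = 1 := by
      refine tendsto_nhds_unique h1 ?_
      simp [Function.comp_def, interleaveOne]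
    subst hg1
    simpa [Function.comp_def, interleaveOne] using h2
  · intro h
    refine ⟨1, ?_⟩
    have hdiv : Tendsto (fun n : ℕ => n / 2) atTop atTop :=
      Nat.tendsto_div_const_atTop two_ne_zero
    refine tendsto_def.2 fun s hs => ?_
    filter_upwards [(h.comp hdiv).eventually_mem hs] with n hn
    by_cases hev : Even n
    · simpa [interleaveOne, hev] using Set.mem_preimage.1 hn
    · simpa [interleaveOne, hev] using mem_of_mem_nhds hs

theorem eZero_reducible_inducedER [DiscreteTopology G] [Nontrivial G] :
    BorelReducible eZero (inducedER G) := by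
  obtain ⟨g, hg⟩ := exists_ne (1 : G)
  let u : (ℕ → Bool) → ℕ → G := fun x n => if x n then g else 1
  have hu : Continuous u := by
    refine continuous_pi fun n => ?_
    exact (continuous_of_discreteTopology (f := fun b : Bool => if b then g else 1)).comp
      (continuous_apply n)
  refine .of_continuous (fun x => interleaveOne (u x)) (continuous_interleaveOne.comp hu) ?_
  intro x y
  rw [inducedER_interleaveOne_iff, eZero_iff, nhds_discrete, tendsto_pure]
  refine eventually_congr (Eventually.of_forall fun n => ?_)
  cases hx : x n <;> cases hy : y n <;> simp [u, hx, hy, hg]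

/-- If `g_k → 1` with all `g_k ≠ 1`, then `E_0^ω` reduces to `E(G)`: the bit `x_k(i)` decides
whether the entry at position `⟨k, i⟩` is `g_k` or `1`. -/
theorem omegaPower_eZero_reducible_inducedER_of_tendsto [T2Space G] (g : ℕ → G)
    (hg : ∀ k, g k ≠ 1) (hlim : Tendsto g atTop (𝓝 1)) :
    BorelReducible (omegaPower eZero) (inducedER G) := by
  let w : ℕ → Bool → G := fun k b => if b then g k else 1
  let u : (ℕ → ℕ → Bool) → ℕ → G := fun x n => w n.unpair.1 (x n.unpair.1 n.unpair.2)
  have hu : Continuous u := by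
    refine continuous_pi fun n => ?_
    exact (continuous_of_discreteTopology (f := w n.unpair.1)).comp
      ((continuous_apply n.unpair.2).comp (continuous_apply n.unpair.1))
  refine .of_continuous (fun x => interleaveOne (u x)) (continuous_interleaveOne.comp hu) ?_
  intro x y
  rw [inducedER_interleaveOne_iff, omegaPower_iff]
  have hne : ∀ k b c, b ≠ c → w k b * (w k c)⁻¹ ≠ 1 := by
    intro k b c hbc
    cases b <;> cases c <;> simp_all [w]
  constructor
  · intro h
    -- All but finitely many quotients lie in the same neighbourhood of `1`, which forces
    -- `u x = u y` outside the finitely many rows `k < K` and finitely many further positions.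
    refine tendsto_def.2 fun s hs => ?_
    have hb : ∀ b c, ∀ᶠ k in atTop, w k b * (w k c)⁻¹ ∈ s := by
      intro b c
      have hw : ∀ b, Tendsto (fun k => w k b) atTop (𝓝 1) := by
        intro b
        cases b
        · simp [w]
        · simpa [w] using hlim
      have := (hw b).mul (hw c).inv
      rw [inv_one, one_mul] at this
      exact this.eventually hs
    have hall : ∀ᶠ k in atTop, ∀ b c, w k b * (w k c)⁻¹ ∈ s := by
      rw [eventually_all]
      intro b
      rw [eventually_all]
      exact hb b
    obtain ⟨K, hK⟩ := eventually_atTop.1 hall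
    have hfin : ∀ k, {i | x k i ≠ y k i}.Finite := by
      intro k
      have := eZero_iff.1 (h k)
      rw [← Nat.cofinite_eq_atTop] at this
      exact this
    have hF : (⋃ k ∈ Finset.range K, (fun i => Nat.pair k i) '' {i | x k i ≠ y k i}).Finite :=
      Set.Finite.biUnion (Finset.finite_toSet _) fun k _ => (hfin k).image _
    rw [← Nat.cofinite_eq_atTop]
    filter_upwards [hF.compl_mem_cofinite] with n hn
    by_cases hlt : n.unpair.1 < K
    · have : x n.unpair.1 n.unpair.2 = y n.unpair.1 n.unpair.2 := by
        by_contra hxy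
        refine hn (Set.mem_biUnion (Finset.mem_coe.2 (Finset.mem_range.2 hlt)) ?_)
        exact ⟨_, hxy, Nat.pair_unpair n⟩
      simpa [u, this] using mem_of_mem_nhds hs
    · exact hK _ (not_lt.1 hlt) _ _
  · intro h k
    have hs : ∀ᶠ z in 𝓝 (1 : G), ∀ b c, b ≠ c → z ≠ w k b * (w k c)⁻¹ := by
      simp only [eventually_all]
      intro b c hbc
      exact isOpen_ne.mem_nhds (hne k b c hbc).symm
    have hpair : Tendsto (fun i => Nat.pair k i) atTop atTop :=
      tendsto_atTop_mono (fun i => Nat.right_le_pair k i) tendsto_id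
    rw [eZero_iff]
    filter_upwards [(h.comp hpair).eventually hs] with i hi
    by_contra hxy
    exact hi _ _ hxy (by simp [u])

theorem omegaPower_eZero_reducible_inducedER [PolishSpace G] [Uncountable G] :
    BorelReducible (omegaPower eZero) (inducedER G) := by
  have hnd : (𝓝[≠] (1 : G)).NeBot := by
    rw [neBot_iff]
    intro h
    have : DiscreteTopology G :=
      discreteTopology_of_isOpen_singleton_one (isOpen_singleton_iff_punctured_nhds 1 |>.2 h)
    exact not_countable (α := G) (TopologicalSpace.separableSpace_iff_countable.1 inferInstance)
  obtain ⟨g, hg⟩ := exists_seq_tendsto (𝓝[≠] (1 : G))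
  obtain ⟨N, hN⟩ := eventually_atTop.1 (hg.eventually self_mem_nhdsWithin)
  exact omegaPower_eZero_reducible_inducedER_of_tendsto (fun k => g (k + N))
    (fun k => hN _ (Nat.le_add_left _ _))
    (((tendsto_nhdsWithin_iff.1 hg).1).comp (tendsto_add_atTop_nat N))

/-- For a countable discrete group, `x_n y_n⁻¹` is eventually constant iff eventually
`x_n⁻¹ x_{n+1} = y_n⁻¹ y_{n+1}`. -/
theorem inducedER_reducible_eZero [Countable G] [DiscreteTopology G] :
    BorelReducible (inducedER G) eZero := by
  obtain ⟨c, hc⟩ := exists_injective_nat G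
  refine .of_continuous (fun x => graphCode fun n => c ((x n)⁻¹ * x (n + 1))) ?_ ?_
  · refine continuous_pi fun n => ?_
    exact (continuous_of_discreteTopology
      (f := fun z : G => decide (c z = n.unpair.2))).comp (by fun_prop)
  intro x y
  rw [eZero_graphCode_iff, inducedER_iff]
  simp only [nhds_discrete, tendsto_pure, hc.eq_iff]
  have key : ∀ n, (x n)⁻¹ * x (n + 1) = (y n)⁻¹ * y (n + 1) ↔
      x (n + 1) * (y (n + 1))⁻¹ = x n * (y n)⁻¹ := by
    intro n
    rw [inv_mul_eq_iff_eq_mul, ← mul_assoc, mul_inv_eq_iff_eq_mul]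
  simp only [key]
  constructor
  · rintro ⟨g, hg⟩
    filter_upwards [hg, (tendsto_add_atTop_nat 1).eventually hg] with n h1 h2
    exact h2.trans h1.symm
  · intro h
    obtain ⟨N, hN⟩ := eventually_atTop.1 h
    refine ⟨x N * (y N)⁻¹, eventually_atTop.2 ⟨N, fun n hn => ?_⟩⟩
    induction n, hn using Nat.le_induction with
    | base => rfl
    | succ n hn ih => exact (hN n hn).trans ih

end Interleave

/-! ### Two-sided completeness of Polish groups -/

section Complete

variable {G : Type*} [Group G] [TopologicalSpace G] [IsTopologicalGroup G]

/-- One step of the approximation: if `(z_n)` is left and right Cauchy, then inside every nonempty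
open set `W` there is a smaller one `W'`, with closure in `W`, which almost all `z_n` map by left
translation into one and the same small set. -/
theorem exists_small_translates [RegularSpace G] {z : ℕ → G}
    (hl : ∀ U ∈ 𝓝 (1 : G), ∃ N, ∀ m ≥ N, ∀ n ≥ N, (z m)⁻¹ * z n ∈ U)
    (hr : ∀ U ∈ 𝓝 (1 : G), ∃ N, ∀ m ≥ N, ∀ n ≥ N, z m * (z n)⁻¹ ∈ U)
    (S : Set G → Prop) (hS : ∀ x, ∃ O ∈ 𝓝 x, S O)
    {W : Set G} (hW : IsOpen W) (hne : W.Nonempty) :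
    ∃ W' : Set G, IsOpen W' ∧ W'.Nonempty ∧ closure W' ⊆ W ∧
      (∃ O, S O ∧ W' ⊆ O) ∧ ∃ O, S O ∧ ∃ N, ∀ m ≥ N, ∀ g ∈ W', z m * g ∈ O := by
  obtain ⟨g, hg⟩ := hne
  have h1 : (fun v => v * g) ⁻¹' W ∈ 𝓝 (1 : G) :=
    (continuous_mul_const g).continuousAt.preimage_mem_nhds (by simpa using hW.mem_nhds hg)
  obtain ⟨N, hN⟩ := hl _ h1
  -- `w = z_N g` satisfies `z_m⁻¹ w ∈ W` for all large `m`.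
  set w := z N * g with hw
  obtain ⟨O, hO, hSO⟩ := hS w
  have h2 : (fun p : G × G => p.1 * p.2 * w) ⁻¹' O ∈ 𝓝 ((1 : G), (1 : G)) :=
    (Continuous.continuousAt (by fun_prop)).preimage_mem_nhds (by simpa using hO)
  rw [nhds_prod_eq, mem_prod_iff] at h2
  obtain ⟨A, hA, B, hB, hAB⟩ := h2
  obtain ⟨N', hN'⟩ := hr A hA
  set M := max N N' with hM
  set w' := (z M)⁻¹ * w with hw'
  have hw'W : w' ∈ W := by
    have := hN M (le_max_left _ _) N le_rfl
    simpa [hw', hw, mul_assoc] using this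
  obtain ⟨O', hO', hSO'⟩ := hS w'
  have hB' : (fun x => z M * x * w⁻¹) ⁻¹' B ∈ 𝓝 w' :=
    (Continuous.continuousAt (by fun_prop)).preimage_mem_nhds (by simpa [hw'] using hB)
  obtain ⟨C, ⟨hC, hCc⟩, hCW⟩ := (closed_nhds_basis w').mem_iff.1
    (inter_mem (inter_mem (hW.mem_nhds hw'W) hO') hB')
  refine ⟨interior C, isOpen_interior, ⟨w', mem_interior_iff_mem_nhds.2 hC⟩, ?_, ?_, ?_⟩
  · exact (closure_minimal interior_subset hCc).trans fun x hx => (hCW hx).1.1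
  · exact ⟨O', hSO', fun x hx => (hCW (interior_subset hx)).1.2⟩
  · refine ⟨O, hSO, M, fun m hm x hx => ?_⟩
    have hx' : z M * x * w⁻¹ ∈ B := (hCW (interior_subset hx)).2
    have hm' : z m * (z M)⁻¹ ∈ A := hN' m ((le_max_right _ _).trans hm) M (le_max_right _ _)
    have := hAB (Set.mk_mem_prod hm' hx')
    simpa [mul_assoc] using this

/-- A completely metrizable group is complete for its two-sided uniformity: it contains the limit of
every sequence that is both left and right Cauchy. A Baire category argument yields a `g` for which
`z_n g` is Cauchy for a complete metric. -/
theorem exists_tendsto_of_left_right_cauchy [PolishSpace G] {z : ℕ → G}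
    (hl : ∀ U ∈ 𝓝 (1 : G), ∃ N, ∀ m ≥ N, ∀ n ≥ N, (z m)⁻¹ * z n ∈ U)
    (hr : ∀ U ∈ 𝓝 (1 : G), ∃ N, ∀ m ≥ N, ∀ n ≥ N, z m * (z n)⁻¹ ∈ U) :
    ∃ g, Tendsto z atTop (𝓝 g) := by
  let _ := TopologicalSpace.upgradeIsCompletelyMetrizable G
  have hS : ∀ (j : ℕ) (x : G), ∃ O ∈ 𝓝 x, ∀ a ∈ O, ∀ b ∈ O, dist a b < 1 / ((j : ℝ) + 1) := by
    intro j x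
    have hpos : (0 : ℝ) < 1 / ((j : ℝ) + 1) := Nat.one_div_pos_of_nat
    refine ⟨Metric.ball x (1 / ((j : ℝ) + 1) / 2), Metric.ball_mem_nhds _ (half_pos hpos), ?_⟩
    intro a ha b hb
    calc dist a b ≤ dist a x + dist b x := dist_triangle_right _ _ _
      _ < 1 / ((j : ℝ) + 1) / 2 + 1 / ((j : ℝ) + 1) / 2 := add_lt_add ha hb
      _ = _ := add_halves _
  have step : ∀ (j : ℕ) (W : {W : Set G // IsOpen W ∧ W.Nonempty}),
      ∃ W' : {W : Set G // IsOpen W ∧ W.Nonempty}, closure W'.1 ⊆ W.1 ∧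
        (∀ a ∈ W'.1, ∀ b ∈ W'.1, dist a b < 1 / ((j : ℝ) + 1)) ∧
        ∃ N, ∀ m ≥ N, ∀ n ≥ N, ∀ g ∈ W'.1, dist (z m * g) (z n * g) < 1 / ((j : ℝ) + 1) := by
    intro j ⟨W, hWo, hWn⟩
    obtain ⟨W', ho, hn, hcl, ⟨O', hO', hWO'⟩, O, hO, N, hN⟩ :=
      exists_small_translates hl hr _ (hS j) hWo hWn
    exact ⟨⟨W', ho, hn⟩, hcl, fun a ha b hb => hO' a (hWO' ha) b (hWO' hb), N,
      fun m hm n hn g hg => hO _ (hN m hm g hg) _ (hN n hn g hg)⟩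
  choose next hcl hdiam hz using step
  let W : ℕ → {W : Set G // IsOpen W ∧ W.Nonempty} := fun k =>
    Nat.rec ⟨Set.univ, isOpen_univ, Set.univ_nonempty⟩ next k
  have hWs : ∀ k, W (k + 1) = next k (W k) := fun k => rfl
  have hanti : ∀ k, closure (W (k + 1)).1 ⊆ (W k).1 := fun k => by rw [hWs]; exact hcl k (W k)
  have hanti' : Antitone fun k => (W k).1 :=
    antitone_nat_of_succ_le fun k => subset_closure.trans (hanti k)
  choose p hp using fun k => (W k).2.2
  have hsmall : ∀ ε > 0, ∃ j : ℕ, 1 / ((j : ℝ) + 1) < ε := fun ε hε =>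
    exists_nat_one_div_lt hε
  have hpc : CauchySeq p := by
    rw [Metric.cauchySeq_iff]
    intro ε hε
    obtain ⟨j, hj⟩ := hsmall ε hε
    refine ⟨j + 1, fun m hm n hn => lt_trans ?_ hj⟩
    exact hdiam j (W j) _ (hanti' hm (hp m)) _ (hanti' hn (hp n))
  obtain ⟨g, hg⟩ := cauchySeq_tendsto_of_complete hpc
  have hgW : ∀ k, g ∈ (W k).1 := by
    intro k
    refine hanti k (mem_closure_of_tendsto hg ?_)
    filter_upwards [eventually_ge_atTop (k + 1)] with n hn using hanti' hn (hp n)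
  have hzg : CauchySeq fun n => z n * g := by
    rw [Metric.cauchySeq_iff]
    intro ε hε
    obtain ⟨j, hj⟩ := hsmall ε hε
    obtain ⟨N, hN⟩ := hz j (W j)
    exact ⟨N, fun m hm n hn => (hN m hm n hn g (hgW (j + 1))).trans hj⟩
  obtain ⟨h, hh⟩ := cauchySeq_tendsto_of_complete hzg
  exact ⟨h * g⁻¹, by simpa using hh.mul_const g⁻¹⟩

end Complete

/-! ### Upper bounds for `E(G)` when `G` is non-archimedean -/

section Nonarchimedean

variable {G : Type*} [Group G] [TopologicalSpace G]

/-- An open subgroup of a separable group has countably many cosets, so its right cosets `V g` can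
be coded by natural numbers. -/
theorem exists_rightCoset_code [IsTopologicalGroup G] [TopologicalSpace.SeparableSpace G]
    (V : OpenSubgroup G) :
    ∃ c : G → ℕ, Continuous c ∧ ∀ a b, c a = c b ↔ a * b⁻¹ ∈ V := by
  obtain ⟨d, hd⟩ := TopologicalSpace.exists_dense_seq G
  have hex : ∀ a, ∃ n, a * (d n)⁻¹ ∈ V := by
    intro a
    have ho : IsOpen {x | a * x⁻¹ ∈ V} := V.isOpen.preimage (by fun_prop)
    obtain ⟨n, hn⟩ := hd.exists_mem_open ho ⟨a, by simp⟩
    exact ⟨n, hn⟩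
  classical
  refine ⟨fun a => Nat.find (hex a), ?_, ?_⟩
  · -- The code is constant on each right coset, hence locally constant.
    refine IsLocallyConstant.continuous ((IsLocallyConstant.iff_exists_open _).2 fun a => ?_)
    refine ⟨{x | x * a⁻¹ ∈ V}, V.isOpen.preimage (by fun_prop), by simp, ?_⟩
    intro x hx
    refine Nat.find_congr' fun {n} => ?_
    have : x * (d n)⁻¹ = (x * a⁻¹) * (a * (d n)⁻¹) := by group
    rw [this]
    exact mul_mem_cancel_left (H := V) hx
  · intro a b
    constructor
    · intro h
      have ha := Nat.find_spec (hex a)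
      have hb := Nat.find_spec (hex b)
      replace h : Nat.find (hex a) = Nat.find (hex b) := h
      rw [h] at ha
      simpa using V.mul_mem ha (V.inv_mem hb)
    · intro h
      refine Nat.find_congr' fun {n} => ?_
      have : a * (d n)⁻¹ = (a * b⁻¹) * (b * (d n)⁻¹) := by group
      rw [this]
      exact mul_mem_cancel_left (H := V) h

/-- A basis of neighbourhoods of `1` consisting of open subgroups, chosen with a property `P`. -/
theorem exists_seq_openSubgroup [FirstCountableTopology G] (P : OpenSubgroup G → Prop)
    (hP : ∀ U ∈ 𝓝 (1 : G), ∃ V : OpenSubgroup G, P V ∧ (V : Set G) ⊆ U) :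
    ∃ V : ℕ → OpenSubgroup G, (∀ k, P (V k)) ∧ ∀ U ∈ 𝓝 (1 : G), ∃ k, (V k : Set G) ⊆ U := by
  obtain ⟨U, hU⟩ := (𝓝 (1 : G)).exists_antitone_basis
  choose V hPV hV using fun k => hP (U k) (hU.mem k)
  refine ⟨V, hPV, fun W hW => ?_⟩
  obtain ⟨k, -, hk⟩ := hU.1.mem_iff.1 hW
  exact ⟨k, (hV k).trans hk⟩

theorem inducedER_reducible_eqPlus [PolishSpace G] [NonarchimedeanGroup G] :
    BorelReducible (inducedER G) eqPlus := by
  obtain ⟨V, -, hV⟩ := exists_seq_openSubgroup (G := G) (fun _ => True) (fun U hU => by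
    simpa using NonarchimedeanGroup.is_nonarchimedean U hU)
  choose c hc hcV using fun k => exists_rightCoset_code (V k)
  obtain ⟨d, hd⟩ := TopologicalSpace.exists_dense_seq G
  -- The set coded by `x` consists of the pairs `(k, s)` where `s : ω → ω` is eventually equal to
  -- the sequence of cosets `V_k d_i x_n` for some `i`.
  let e : ℕ → ℕ × ℕ × List ℕ := fun j => (Encodable.decode j).getD default
  have he : Function.Surjective e := fun a => ⟨Encodable.encode a, by
    change (Encodable.decode (Encodable.encode a)).getD default = a
    rw [Encodable.encodek, Option.getD_some]⟩
  let θ : (ℕ → G) → ℕ → ℕ → ℕ := fun x j m =>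
    Nat.casesOn m (e j).1 fun m => (e j).2.2[m]?.getD (c (e j).1 (d (e j).2.1 * x m))
  have hθ : ∀ x y, Set.range (θ x) ⊆ Set.range (θ y) ↔ ∀ k i, ∃ i', ∀ᶠ n in atTop,
      c k (d i * x n) = c k (d i' * y n) := by
    intro x y
    constructor
    · intro h k i
      obtain ⟨j, hj⟩ := he (k, i, [])
      obtain ⟨j', hj'⟩ := h ⟨j, rfl⟩
      refine ⟨(e j').2.1, ?_⟩
      have hk : (e j').1 = k := by
        have := congrFun hj' 0
        simpa [θ, hj] using this
      filter_upwards [eventually_ge_atTop (e j').2.2.length] with n hn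
      have := congrFun hj' (n + 1)
      simp only [θ, hj, List.getElem?_eq_none hn, hk] at this
      simpa using this.symm
    · rintro h _ ⟨j, rfl⟩
      obtain ⟨i', hi'⟩ := h (e j).1 (e j).2.1
      obtain ⟨N, hN⟩ := eventually_atTop.1 hi'
      -- The prefix is long enough to hold all disagreements.
      set L := max N (e j).2.2.length with hL
      obtain ⟨j', hj'⟩ := he ((e j).1, i', List.ofFn fun m : Fin L => θ x j (m + 1))
      refine ⟨j', funext fun m => ?_⟩
      cases m with
      | zero => simp [θ, hj']
      | succ m =>
        by_cases hm : m < L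
        · simp [θ, hj', hm]
        · have h1 : (e j).2.2.length ≤ m := (le_max_right _ _).trans (not_lt.1 hm)
          have h2 := hN m ((le_max_left _ _).trans (not_lt.1 hm))
          simp [θ, hj', hm, List.getElem?_eq_none h1, h2]
  refine .of_continuous θ ?_ ?_
  · refine continuous_pi fun j => continuous_pi fun m => ?_
    cases m with
    | zero => exact continuous_const
    | succ m =>
      change Continuous fun x : ℕ → G => (e j).2.2[m]?.getD (c (e j).1 (d (e j).2.1 * x m))
      cases (e j).2.2[m]? with
      | none => exact (hc _).comp (by fun_prop)
      | some a => exact continuous_const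
  have hcong : ∀ k a b u v, c k (a * u) = c k (b * v) ↔ a * (u * v⁻¹) * b⁻¹ ∈ V k := by
    intro k a b u v
    rw [hcV]
    simp [mul_assoc]
  have hdV : ∀ k a, ∃ i, a * (d i)⁻¹ ∈ V k := by
    intro k a
    have ho : IsOpen {x | a * x⁻¹ ∈ V k} := (V k).isOpen.preimage (by fun_prop)
    obtain ⟨n, hn⟩ := hd.exists_mem_open ho ⟨a, by simp⟩
    exact ⟨n, hn⟩
  have forward : ∀ x y, inducedER G x y → Set.range (θ x) ⊆ Set.range (θ y) := by
    rintro x y ⟨g, hg⟩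
    rw [hθ]
    intro k i
    obtain ⟨i', hi'⟩ := hdV k (d i * g)
    refine ⟨i', ?_⟩
    have ho : IsOpen {z | d i * z * (d i')⁻¹ ∈ V k} := (V k).isOpen.preimage (by fun_prop)
    filter_upwards [hg.eventually_mem (ho.mem_nhds hi')] with n hn
    exact (hcong _ _ _ _ _).2 hn
  -- Inclusion of the coded sets bounds the quotients modulo right cosets.
  have backward : ∀ x y, Set.range (θ x) ⊆ Set.range (θ y) → ∀ U ∈ 𝓝 (1 : G), ∃ N,
      ∀ m ≥ N, ∀ n ≥ N, (x m * (y m)⁻¹) * (x n * (y n)⁻¹)⁻¹ ∈ U := by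
    intro x y h U hU
    obtain ⟨k, hk⟩ := hV U hU
    obtain ⟨i, hi⟩ := hdV k 1
    obtain ⟨i', hi'⟩ := (hθ x y).1 h k i
    obtain ⟨N, hN⟩ := eventually_atTop.1 hi'
    refine ⟨N, fun m hm n hn => hk ?_⟩
    have h1 := (hcong _ _ _ _ _).1 (hN m hm)
    have h2 := (hcong _ _ _ _ _).1 (hN n hn)
    have h3 := (V k).mul_mem h1 ((V k).inv_mem h2)
    have hi2 : d i ∈ V k := by simpa using hi
    have h4 := (V k).mul_mem ((V k).mul_mem ((V k).inv_mem hi2) h3) hi2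
    have : (d i)⁻¹ * (d i * (x m * (y m)⁻¹) * (d i')⁻¹ * (d i * (x n * (y n)⁻¹) * (d i')⁻¹)⁻¹)
        * d i = (x m * (y m)⁻¹) * (x n * (y n)⁻¹)⁻¹ := by group
    rwa [this] at h4
  intro x y
  rw [eqPlus_iff, Set.Subset.antisymm_iff]
  constructor
  · exact fun h => ⟨forward x y h, forward y x ((inducedER G).symm h)⟩
  · rintro ⟨h1, h2⟩
    refine exists_tendsto_of_left_right_cauchy (fun U hU => ?_) (backward x y h1)
    obtain ⟨N, hN⟩ := backward y x h2 U hU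
    exact ⟨N, fun m hm n hn => by simpa using hN m hm n hn⟩

/-- In a non-archimedean group with a two-sided invariant metric the open normal subgroups form a
basis at `1`: a ball around `1` is conjugation invariant, so it generates a normal subgroup. -/
theorem IsTSI.exists_normal_openSubgroup [NonarchimedeanGroup G] (h : IsTSI G) {U : Set G}
    (hU : U ∈ 𝓝 (1 : G)) :
    ∃ V : OpenSubgroup G, (V : Subgroup G).Normal ∧ (V : Set G) ⊆ U := by
  obtain ⟨H, hH⟩ := NonarchimedeanGroup.is_nonarchimedean U hU
  obtain ⟨d, hd, hl, hr⟩ := h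
  have hnhds : ∀ s : Set G, s ∈ 𝓝 (1 : G) ↔ ∃ ε > 0, {x | d.dist x 1 < ε} ⊆ s := by
    intro s
    subst hd
    exact Metric.mem_nhds_iff
  obtain ⟨ε, hε, hB⟩ := (hnhds H).1 (H.isOpen.mem_nhds H.one_mem)
  set B : Set G := {x | d.dist x 1 < ε} with hBdef
  have hconj : ∀ g x, d.dist (g * x * g⁻¹) 1 = d.dist x 1 := by
    intro g x
    have h1 := hr g⁻¹ (g * x) g
    rw [mul_inv_cancel] at h1
    rw [h1]
    simpa using hl g x 1
  have hle : Subgroup.normalClosure B ≤ (H : Subgroup G) := by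
    rw [Subgroup.normalClosure, Subgroup.closure_le]
    intro y hy
    obtain ⟨x, hx, hxy⟩ := Group.mem_conjugatesOfSet_iff.1 hy
    obtain ⟨g, rfl⟩ := isConj_iff.1 hxy
    refine hB ?_
    change d.dist (g * x * g⁻¹) 1 < ε
    rw [hconj]
    exact hx
  have hopen : IsOpen (Subgroup.normalClosure B : Set G) :=
    Subgroup.isOpen_of_mem_nhds _ (g := 1)
      (mem_of_superset ((hnhds B).2 ⟨ε, hε, subset_rfl⟩) Subgroup.subset_normalClosure)
  exact ⟨⟨Subgroup.normalClosure B, hopen⟩, Subgroup.normalClosure_normal,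
    fun x hx => hH (hle hx)⟩

theorem inducedER_reducible_omegaPower_eZero [PolishSpace G] [NonarchimedeanGroup G]
    (h : IsTSI G) : BorelReducible (inducedER G) (omegaPower eZero) := by
  obtain ⟨V, hVn, hV⟩ := exists_seq_openSubgroup (G := G) (fun V => (V : Subgroup G).Normal)
    (fun U hU => h.exists_normal_openSubgroup hU)
  choose c hc hcV using fun k => exists_rightCoset_code (V k)
  refine .of_continuous (fun x k => graphCode fun n => c k ((x n)⁻¹ * x (n + 1))) ?_ ?_
  · refine continuous_pi fun k => continuous_pi fun n => ?_
    exact (continuous_of_discreteTopology (f := fun m : ℕ => decide (m = n.unpair.2))).comp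
      ((hc k).comp (by fun_prop))
  intro x y
  simp only [omegaPower_iff, eZero_graphCode_iff, hcV]
  set z : ℕ → G := fun n => x n * (y n)⁻¹ with hz
  have key : ∀ k n, (x n)⁻¹ * x (n + 1) * ((y n)⁻¹ * y (n + 1))⁻¹ ∈ V k ↔
      (z n)⁻¹ * z (n + 1) ∈ V k := by
    intro k n
    have := (hVn k).mem_comm_iff (a := (x n)⁻¹ * x (n + 1) * (y (n + 1))⁻¹) (b := y n)
    simpa [hz, mul_assoc] using this
  simp only [key]
  constructor
  · rintro ⟨g, hg⟩ k
    have h1 := hg.inv.mul (hg.comp (tendsto_add_atTop_nat 1))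
    rw [inv_mul_cancel] at h1
    exact h1.eventually_mem ((V k).isOpen.mem_nhds (V k).one_mem)
  · intro hk
    have hl : ∀ U ∈ 𝓝 (1 : G), ∃ k, (V k : Set G) ⊆ U ∧ ∃ N, ∀ m ≥ N, ∀ n ≥ N,
        (z m)⁻¹ * z n ∈ V k := by
      intro U hU
      obtain ⟨k, hkU⟩ := hV U hU
      obtain ⟨N, hN⟩ := eventually_atTop.1 (hk k)
      have hbase : ∀ n ≥ N, (z N)⁻¹ * z n ∈ V k := by
        intro n hn
        induction n, hn using Nat.le_induction with
        | base => simp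
        | succ n hn ih => simpa [mul_assoc] using (V k).mul_mem ih (hN n hn)
      refine ⟨k, hkU, N, fun m hm n hn => ?_⟩
      simpa [mul_assoc] using (V k).mul_mem ((V k).inv_mem (hbase m hm)) (hbase n hn)
    refine exists_tendsto_of_left_right_cauchy (fun U hU => ?_) (fun U hU => ?_)
    · obtain ⟨k, hkU, N, hN⟩ := hl U hU
      exact ⟨N, fun m hm n hn => hkU (hN m hm n hn)⟩
    · obtain ⟨k, hkU, N, hN⟩ := hl U hU
      exact ⟨N, fun m hm n hn => hkU (((hVn k).mem_comm_iff).1 (hN n hn m hm))⟩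

end Nonarchimedean

/-! ### Baire category in product spaces -/

section Category

theorem not_eventually_residual_notMem {X : Type*} [TopologicalSpace X] [BaireSpace X] {O : Set X}
    (hO : IsOpen O) (hne : O.Nonempty) : ¬ ∀ᶠ x in residual X, x ∉ O := by
  intro h
  obtain ⟨x, hx, hxO⟩ := (dense_of_mem_residual h).exists_mem_open hO hne
  exact hx hxO

/-- A Borel property that fails to hold generically fails generically on a nonempty open set. -/
theorem exists_isOpen_of_not_eventually_residual {X : Type*} [TopologicalSpace X]
    [MeasurableSpace X] [BorelSpace X] {P : X → Prop} (hP : MeasurableSet {x | P x})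
    (h : ¬ ∀ᶠ x in residual X, P x) :
    ∃ O : Set X, IsOpen O ∧ O.Nonempty ∧ ∀ᶠ x in residual X, x ∈ O → ¬ P x := by
  obtain ⟨O, hO, hPO⟩ := hP.compl.residualEq_isOpen
  rw [eventuallyEq_set] at hPO
  refine ⟨O, hO, ?_, hPO.mono fun x hx hxO => hx.2 hxO⟩
  rw [Set.nonempty_iff_ne_empty]
  rintro rfl
  exact h (hPO.mono fun x hx => not_not.1 hx.1)

theorem tendsto_fst_residual {X D : Type*} [TopologicalSpace X] [TopologicalSpace D] :
    Tendsto (Prod.fst : X × D → X) (residual (X × D)) (residual X) :=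
  tendsto_residual_of_isOpenMap continuous_fst isOpenMap_fst

/-- A Borel property of the first coordinate that holds generically on `U ×ˢ V` holds generically
on `U`. -/
theorem eventually_residual_of_prod {X D : Type*} [TopologicalSpace X] [TopologicalSpace D]
    [BaireSpace (X × D)] [MeasurableSpace X] [BorelSpace X] {U : Set X} {V : Set D} {P : X → Prop}
    (hU : IsOpen U) (hV : IsOpen V) (hVne : V.Nonempty) (hP : MeasurableSet {x | P x})
    (h : ∀ᶠ p in residual (X × D), p.1 ∈ U → p.2 ∈ V → P p.1) :
    ∀ᶠ x in residual X, x ∈ U → P x := by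
  by_contra hc
  have hm : MeasurableSet {x | x ∈ U → P x} := by
    simp only [imp_iff_not_or]
    exact hU.measurableSet.compl.union hP
  obtain ⟨O, hO, hOne, hOP⟩ := exists_isOpen_of_not_eventually_residual hm hc
  refine not_eventually_residual_notMem (hO.prod hV) (hOne.prod hVne) ?_
  filter_upwards [h, tendsto_fst_residual.eventually hOP] with p h1 h2 hp
  exact h2 hp.1 fun hpU => h1 hpU hp.2

/-- The shear `(x, δ) ↦ (x + φ δ, δ)` of a product. -/
def shear {X D : Type*} [AddCommGroup X] [TopologicalSpace X] [IsTopologicalAddGroup X]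
    [TopologicalSpace D] (φ : D → X) (hφ : Continuous φ) : X × D ≃ₜ X × D where
  toFun p := (p.1 + φ p.2, p.2)
  invFun p := (p.1 - φ p.2, p.2)
  left_inv p := by simp
  right_inv p := by simp
  continuous_toFun := by fun_prop
  continuous_invFun := by fun_prop

theorem tendsto_shear_residual {X D : Type*} [AddCommGroup X] [TopologicalSpace X]
    [IsTopologicalAddGroup X] [TopologicalSpace D] {φ : D → X} (hφ : Continuous φ) :
    Tendsto (fun p : X × D => p.1 + φ p.2) (residual (X × D)) (residual X) :=
  tendsto_fst_residual.comp
    (tendsto_residual_of_isOpenMap (shear φ hφ).continuous (shear φ hφ).isOpenMap)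

theorem tendsto_add_const_residual {X : Type*} [AddCommGroup X] [TopologicalSpace X]
    [IsTopologicalAddGroup X] (e : X) :
    Tendsto (fun x : X => x + e) (residual X) (residual X) :=
  tendsto_residual_of_isOpenMap (Homeomorph.addRight e).continuous (Homeomorph.addRight e).isOpenMap

/-- Generically, prescribed open conditions that can be met near infinity are met infinitely often:
if `q_n → p` with `q_n ∈ O_n` open, for every `p`, then generically `p ∈ O_n` infinitely often. -/
theorem eventually_residual_frequently {X : Type*} [TopologicalSpace X] {O : ℕ → Set X}
    (hO : ∀ n, IsOpen (O n))
    (h : ∀ p, ∃ q : ℕ → X, Tendsto q atTop (𝓝 p) ∧ ∀ n, q n ∈ O n) :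
    ∀ᶠ p in residual X, ∃ᶠ n in atTop, p ∈ O n := by
  have hN : ∀ N : ℕ, ∀ᶠ p in residual X, p ∈ ⋃ n ≥ N, O n := by
    intro N
    refine residual_of_dense_open (isOpen_biUnion fun n _ => hO n) fun p => ?_
    obtain ⟨q, hq, hqO⟩ := h p
    refine mem_closure_of_tendsto hq ?_
    filter_upwards [eventually_ge_atTop N] with n hn
    exact Set.mem_biUnion hn (hqO n)
  filter_upwards [eventually_countable_forall.2 hN] with p hp
  rw [frequently_atTop]
  intro N
  obtain ⟨n, hn, hpn⟩ := Set.mem_iUnion₂.1 (hp N)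
  exact ⟨n, hn, hpn⟩

end Category

/-! ### Generic invariance under small perturbations -/

section Perturb

variable {A : Type*} [AddCommGroup A]

/-- The element of `A^ω` with `n`-th entry `a (δ n)`. -/
def perturb (a : ℕ → A) (δ : ℕ → ℕ) (n : ℕ) : A := a (δ n)

/-- Replaces the entries with index below `K` by `0`. -/
def tailFrom (K : ℕ) (η : ℕ → A) (n : ℕ) : A := if K ≤ n then η n else 0

/-- Membership in `U` depends only on the entries with index below `K`. -/
def DependsBelow {B : Type*} (K : ℕ) (U : Set (ℕ → B)) : Prop :=
  ∀ x y : ℕ → B, (∀ k < K, x k = y k) → (x ∈ U ↔ y ∈ U)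

/-- Every nonempty open set of `B^ω × ω^ω` contains a product of basic open sets. -/
theorem exists_basic_prod_subset {B : Type*} [TopologicalSpace B]
    {O : Set ((ℕ → B) × (ℕ → ℕ))} (hO : IsOpen O) (hne : O.Nonempty) : ∃ (K : ℕ) (U : Set (ℕ → B)) (ε : ℕ → ℕ), IsOpen U ∧ U.Nonempty ∧
      DependsBelow K U ∧ ∀ x ∈ U, ∀ δ : ℕ → ℕ, (∀ k < K, δ k = ε k) → (x, δ) ∈ O := by
  obtain ⟨⟨x, ε⟩, hp⟩ := hne
  obtain ⟨U', V', hU', hV', hx, hε, hUV⟩ := isOpen_prod_iff.1 hO x ε hp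
  obtain ⟨I, u, hu, huU⟩ := isOpen_pi_iff.1 hU' x hx
  obtain ⟨J, v, hv, hvV⟩ := isOpen_pi_iff.1 hV' ε hε
  obtain ⟨K, hK⟩ := (I ∪ J).exists_nat_subset_range
  have hIK : ∀ i ∈ I, i < K := fun i hi => Finset.mem_range.1 (hK (Finset.mem_union_left _ hi))
  have hJK : ∀ i ∈ J, i < K := fun i hi => Finset.mem_range.1 (hK (Finset.mem_union_right _ hi))
  refine ⟨K, Set.pi I u, ε, isOpen_set_pi I.finite_toSet fun i hi => (hu i hi).1,
    ⟨x, fun i hi => (hu i hi).2⟩, ?_, ?_⟩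
  · intro y z hyz
    refine forall₂_congr fun i hi => ?_
    rw [hyz i (hIK i hi)]
  · intro y hy δ hδ
    refine hUV ⟨huU hy, hvV fun i hi => ?_⟩
    change δ i ∈ v i
    rw [hδ i (hJK i hi)]
    exact (hv i hi).2

variable [TopologicalSpace A]

omit [AddCommGroup A] in
theorem continuous_perturb (a : ℕ → A) : Continuous (perturb a) :=
  continuous_pi fun n => (continuous_of_discreteTopology (f := a)).comp (continuous_apply n)

theorem continuous_tailFrom (K : ℕ) : Continuous (tailFrom (A := A) K) := by
  refine continuous_pi fun n => ?_
  unfold tailFrom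
  split_ifs <;> fun_prop

/-- Interchanges the values `0` and `c` at the coordinate `n`. -/
def swapCoord (n c : ℕ) : (ℕ → ℕ) ≃ₜ (ℕ → ℕ) where
  toEquiv := Function.Involutive.toPerm
    (fun δ => Function.update δ n (Equiv.swap 0 c (δ n))) (fun δ => by simp)
  continuous_toFun := continuous_id.update n
    ((continuous_of_discreteTopology (f := Equiv.swap 0 c)).comp (continuous_apply n))
  continuous_invFun := continuous_id.update n
    ((continuous_of_discreteTopology (f := Equiv.swap 0 c)).comp (continuous_apply n))

theorem swapCoord_apply (n c : ℕ) (δ : ℕ → ℕ) :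
    swapCoord n c δ = Function.update δ n (Equiv.swap 0 c (δ n)) := rfl

variable [IsTopologicalAddGroup A] [PolishSpace A] [MeasurableSpace A] [BorelSpace A]
  {Y : Type*} [TopologicalSpace Y] [PolishSpace Y] [MeasurableSpace Y] [BorelSpace Y]

/-- If generically `f x = g (x + perturb a δ)`, then generically `f` is invariant under adding
`a c` at a single place: moving the perturbation `a c` from `δ` into `x` does not change the right
hand side. -/
theorem eventually_eq_add_single {a : ℕ → A} (ha : a 0 = 0) {f g : (ℕ → A) → Y}
    (hf : Measurable f) {K : ℕ} {U : Set (ℕ → A)} (hUo : IsOpen U) (hU : DependsBelow K U)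
    (ε : ℕ → ℕ)
    (h : ∀ᶠ p in residual ((ℕ → A) × (ℕ → ℕ)), p.1 ∈ U → (∀ k < K, p.2 k = ε k) →
      f p.1 = g (p.1 + perturb a p.2)) {n : ℕ} (hn : K ≤ n) (c : ℕ) :
    ∀ᶠ x in residual (ℕ → A), x ∈ U → f x = f (x + Pi.single n (a c)) := by
  set e : ℕ → A := Pi.single n (a c) with he
  let Φ := (Homeomorph.addRight e).prodCongr (swapCoord n c)
  have hΦ := tendsto_residual_of_isOpenMap Φ.continuous Φ.isOpenMap
  have hV : IsOpen {δ : ℕ → ℕ | (∀ k < K, δ k = ε k) ∧ δ n = c} := by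
    have h1 : IsOpen {δ : ℕ → ℕ | ∀ k < K, δ k = ε k} := by
      have : {δ : ℕ → ℕ | ∀ k < K, δ k = ε k} =
          Set.pi (Finset.range K : Set ℕ) fun k => {ε k} := by
        ext δ; simp
      rw [this]
      exact isOpen_set_pi (Finset.finite_toSet _) fun _ _ => isOpen_discrete _
    exact h1.inter ((isOpen_discrete ({c} : Set ℕ)).preimage
      (continuous_apply (A := fun _ : ℕ => ℕ) n))
  refine eventually_residual_of_prod (D := ℕ → ℕ) hUo hV
    ⟨fun k => if k < K then ε k else c, fun k hk => by simp [hk], by simp [hn]⟩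
    (measurableSet_eq_fun hf (hf.comp (continuous_add_const e).measurable)) ?_
  filter_upwards [h, hΦ.eventually h] with p h1 h2 hpU hpV
  have hlt : ∀ k < K, k ≠ n := fun k hk => (hk.trans_le hn).ne
  have hU' : p.1 + e ∈ U := (hU _ _ fun k hk => by simp [he, hlt k hk]).1 hpU
  have h3 : f (p.1 + e) = g (p.1 + e + perturb a (swapCoord n c p.2)) := by
    refine h2 hU' fun k hk => ?_
    change swapCoord n c p.2 k = ε k
    rw [swapCoord_apply, Function.update_of_ne (hlt k hk)]
    exact hpV.1 k hk
  rw [h1 hpU hpV.1, h3]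
  congr 1
  funext k
  by_cases hk : k = n
  · subst hk
    simp [perturb, swapCoord_apply, he, hpV.2, ha]
  · simp [perturb, swapCoord_apply, he, hk]

omit [TopologicalSpace A] [IsTopologicalAddGroup A] [PolishSpace A] [MeasurableSpace A]
  [BorelSpace A] in
theorem DependsBelow.add_mem_iff {K : ℕ} {U : Set (ℕ → A)} (hU : DependsBelow K U) {γ : ℕ → A}
    (hγ : ∀ k < K, γ k = 0) (x : ℕ → A) : x + γ ∈ U ↔ x ∈ U :=
  hU _ _ fun k hk => by simp [hγ k hk]

/-- The group of the translations, trivial below `K`, that generically preserve `f` on `U`. -/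
def genericStabilizer (f : (ℕ → A) → Y) {K : ℕ} {U : Set (ℕ → A)} (hU : DependsBelow K U) :
    AddSubgroup (ℕ → A) where
  carrier := {γ | (∀ k < K, γ k = 0) ∧ ∀ᶠ x in residual (ℕ → A), x ∈ U → f x = f (x + γ)}
  zero_mem' := by simp
  add_mem' := by
    rintro γ γ' ⟨h0, h⟩ ⟨h0', h'⟩
    refine ⟨fun k hk => by simp [h0 k hk, h0' k hk], ?_⟩
    filter_upwards [h, (tendsto_add_const_residual γ).eventually h'] with x h1 h2 hx
    rw [h1 hx, h2 ((hU.add_mem_iff h0 x).2 hx), add_assoc]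
  neg_mem' := by
    rintro γ ⟨h0, h⟩
    have h0' : ∀ k < K, (-γ) k = 0 := fun k hk => by simp [h0 k hk]
    refine ⟨h0', ?_⟩
    filter_upwards [(tendsto_add_const_residual (-γ)).eventually h] with x h1 hx
    simpa using (h1 ((hU.add_mem_iff h0' x).2 hx)).symm

omit [IsTopologicalAddGroup A] [PolishSpace A] [MeasurableSpace A] [BorelSpace A] in
/-- If a subgroup of `A^ω` contains, at every place `n ≥ K`, the elements of a set that generates a
dense subgroup of `A`, then every nonempty open set has a member whose tail lies in the subgroup. -/
theorem exists_tailFrom_mem {S : Set A} (hS : Dense (AddSubgroup.closure S : Set A))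
    {Γ : AddSubgroup (ℕ → A)} {K : ℕ} (hΓ : ∀ n ≥ K, ∀ b ∈ S, Pi.single n b ∈ Γ)
    {V : Set (ℕ → A)} (hV : IsOpen V) (hne : V.Nonempty) : ∃ η ∈ V, tailFrom K η ∈ Γ := by
  obtain ⟨η₀, hη₀⟩ := hne
  obtain ⟨I, u, hu, huV⟩ := isOpen_pi_iff.1 hV η₀ hη₀
  have hex : ∀ i, ∃ b ∈ AddSubgroup.closure S, i ∈ I → b ∈ u i := by
    intro i
    by_cases hi : i ∈ I
    · obtain ⟨b, hb, hbu⟩ := hS.exists_mem_open (hu i hi).1 ⟨_, (hu i hi).2⟩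
      exact ⟨b, hb, fun _ => hbu⟩
    · exact ⟨0, zero_mem _, fun h => absurd h hi⟩
  choose b hbS hbu using hex
  refine ⟨fun i => if i ∈ I then b i else 0, huV fun i hi => ?_, ?_⟩
  · have hi' : i ∈ I := hi
    simpa [hi'] using hbu i hi
  · have hsum : tailFrom K (fun i => if i ∈ I then b i else 0) =
        ∑ i ∈ I with K ≤ i, Pi.single i (b i) := by
      funext n
      rw [Finset.sum_apply, Finset.sum_pi_single]
      by_cases h1 : K ≤ n <;> by_cases h2 : n ∈ I <;> simp [tailFrom, h1, h2]
    rw [hsum]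
    refine sum_mem fun i hi => ?_
    have hle : AddSubgroup.closure S ≤ Γ.comap (AddMonoidHom.single (fun _ : ℕ => A) i) := by
      rw [AddSubgroup.closure_le]
      exact fun s hs => hΓ i (Finset.mem_filter.1 hi).2 s hs
    exact hle (hbS i)

/-- A zero-one law: a Borel map that is generically invariant under a dense group of translations
of the tails is generically invariant under generic translations of the tails. -/
theorem eventually_eq_add_tailFrom {S : Set A} (hS : Dense (AddSubgroup.closure S : Set A))
    {f : (ℕ → A) → Y} (hf : Measurable f) {K : ℕ} {U : Set (ℕ → A)} (hUo : IsOpen U)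
    (hU : DependsBelow K U)
    (h : ∀ n ≥ K, ∀ b ∈ S, ∀ᶠ x in residual (ℕ → A), x ∈ U → f x = f (x + Pi.single n b)) :
    ∀ᶠ p in residual ((ℕ → A) × (ℕ → A)), p.1 ∈ U → f p.1 = f (p.1 + tailFrom K p.2) := by
  have hΓ : ∀ n ≥ K, ∀ b ∈ S, Pi.single n b ∈ genericStabilizer f hU := fun n hn b hb =>
    ⟨fun k hk => by simp [(hk.trans_le hn).ne], h n hn b hb⟩
  have hshift : Measurable fun p : (ℕ → A) × (ℕ → A) => p.1 + tailFrom K p.2 :=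
    (continuous_fst.add ((continuous_tailFrom K).comp continuous_snd)).measurable
  -- It is enough to test the values of `f` on the members of a countable basis of `Y`.
  have hB : ∀ B ∈ TopologicalSpace.countableBasis Y,
      ∀ᶠ p in residual ((ℕ → A) × (ℕ → A)), p.1 ∈ U → f p.1 ∈ B →
        f (p.1 + tailFrom K p.2) ∈ B := by
    intro B hB
    have hBm : MeasurableSet B := (TopologicalSpace.isOpen_of_mem_countableBasis hB).measurableSet
    by_contra hc
    have hm : MeasurableSet {p : (ℕ → A) × (ℕ → A) | p.1 ∈ U → f p.1 ∈ B →
        f (p.1 + tailFrom K p.2) ∈ B} := by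
      simp only [imp_iff_not_or]
      exact (measurable_fst hUo.measurableSet).compl.union
        (((hf.comp measurable_fst) hBm).compl.union ((hf.comp hshift) hBm))
    obtain ⟨O, hO, ⟨⟨x₀, η₁⟩, hp⟩, hOB⟩ := exists_isOpen_of_not_eventually_residual hm hc
    obtain ⟨U', V', hU', hV', hx₀, hη₁, hUV⟩ := isOpen_prod_iff.1 hO x₀ η₁ hp
    push Not at hOB
    have hUB : ∀ᶠ x in residual (ℕ → A), x ∈ U' → x ∈ U ∧ f x ∈ B := by
      refine eventually_residual_of_prod hU' hV' ⟨η₁, hη₁⟩ (hUo.measurableSet.inter (hf hBm)) ?_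
      filter_upwards [hOB] with p hp h1 h2
      have := hp (hUV ⟨h1, h2⟩)
      exact ⟨this.1, this.2.1⟩
    obtain ⟨η₀, hη₀, hγ⟩ := exists_tailFrom_mem hS hΓ hV' ⟨η₁, hη₁⟩
    set γ := tailFrom K η₀
    have hUγ : ∀ᶠ x in residual (ℕ → A), x ∈ U' → f (x + γ) ∈ B := by
      filter_upwards [hUB, hγ.2] with x h1 h2 hx
      rw [← h2 (h1 hx).1]
      exact (h1 hx).2
    -- For `η` near `η₀` the translate `x + tail η` is the `γ`-translate of a point near `x`.
    have hφ : Continuous fun η : ℕ → A => tailFrom K η - γ :=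
      (continuous_tailFrom K).sub continuous_const
    have hO2 : IsOpen {p : (ℕ → A) × (ℕ → A) |
        (p.1 ∈ U' ∧ p.2 ∈ V') ∧ p.1 + (tailFrom K p.2 - γ) ∈ U'} :=
      (hU'.prod hV').inter
        (hU'.preimage (continuous_fst.add (hφ.comp continuous_snd)))
    refine not_eventually_residual_notMem hO2 ⟨(x₀, η₀), ⟨hx₀, hη₀⟩, by simpa [γ] using hx₀⟩ ?_
    filter_upwards [hOB, (tendsto_shear_residual hφ).eventually hUγ] with p h1 h2 hp
    refine (h1 (hUV ⟨hp.1.1, hp.1.2⟩)).2.2 ?_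
    have := h2 hp.2
    rwa [add_assoc, sub_add_cancel] at this
  have hall := (eventually_countable_ball (TopologicalSpace.countable_countableBasis Y)).2 hB
  filter_upwards [hall] with p hp hpU
  by_contra hne
  obtain ⟨B, hB, hfB, hBne⟩ := (TopologicalSpace.isBasis_countableBasis Y).exists_subset_of_mem_open
    (show f p.1 ∈ {f (p.1 + tailFrom K p.2)}ᶜ from hne) isOpen_compl_singleton
  exact hBne (hp B hB hpU hfB) rfl

/-- If `f x` is always one of the countably many values `g_j (x + perturb a δ)`, then locally `f`
is generically invariant under translations of the tails. -/
theorem exists_open_eventually_eq_add_tailFrom {a : ℕ → A} (ha : a 0 = 0)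
    (hS : Dense (AddSubgroup.closure (Set.range a) : Set A)) {f : (ℕ → A) → Y}
    {g : ℕ → (ℕ → A) → Y} (hf : Measurable f) (hg : ∀ j, Measurable (g j))
    (h : ∀ x δ, ∃ j, f x = g j (x + perturb a δ)) {W : Set (ℕ → A)} (hW : IsOpen W)
    (hne : W.Nonempty) :
    ∃ (K : ℕ) (U : Set (ℕ → A)), IsOpen U ∧ U.Nonempty ∧ U ⊆ W ∧
      ∀ᶠ p in residual ((ℕ → A) × (ℕ → A)), p.1 ∈ U → f p.1 = f (p.1 + tailFrom K p.2) := by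
  have hWD : IsOpen (W ×ˢ (Set.univ : Set (ℕ → ℕ))) := hW.prod isOpen_univ
  obtain ⟨j, hj⟩ : ∃ j, ¬ ∀ᶠ p in residual ((ℕ → A) × (ℕ → ℕ)),
      ¬ (p ∈ W ×ˢ (Set.univ : Set (ℕ → ℕ)) ∧ f p.1 = g j (p.1 + perturb a p.2)) := by
    by_contra hall
    rw [not_exists] at hall
    simp only [not_not] at hall
    refine not_eventually_residual_notMem hWD (hne.prod Set.univ_nonempty) ?_
    filter_upwards [eventually_countable_forall.2 hall] with p hp hpW
    obtain ⟨j, hj⟩ := h p.1 p.2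
    exact hp j ⟨hpW, hj⟩
  have hm : MeasurableSet {p : (ℕ → A) × (ℕ → ℕ) |
      ¬ (p ∈ W ×ˢ (Set.univ : Set (ℕ → ℕ)) ∧ f p.1 = g j (p.1 + perturb a p.2))} :=
    (hWD.measurableSet.inter (measurableSet_eq_fun (hf.comp measurable_fst) ((hg j).comp
      (continuous_fst.add ((continuous_perturb a).comp continuous_snd)).measurable))).compl
  obtain ⟨O, hO, hOne, hOj⟩ := exists_isOpen_of_not_eventually_residual hm hj
  simp only [not_not] at hOj
  obtain ⟨p₀, hp₀, hp₀O⟩ := (dense_of_mem_residual hOj).exists_mem_open hO hOne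
  obtain ⟨K, U, ε, hUo, hUne, hU, hUO⟩ :=
    exists_basic_prod_subset (hO.inter hWD) ⟨p₀, hp₀O, (hp₀ hp₀O).1⟩
  refine ⟨K, U, hUo, hUne, fun x hx => (hUO x hx ε fun _ _ => rfl).2.1, ?_⟩
  refine eventually_eq_add_tailFrom hS hf hUo hU ?_
  rintro n hn _ ⟨c, rfl⟩
  refine eventually_eq_add_single ha hf hUo hU ε (g := g j) ?_ hn c
  filter_upwards [hOj] with p hp hpU hpε
  exact (hp (hUO p.1 hpU p.2 hpε).1).2

/-- If the set `{f_l x : l}` is unchanged by perturbations and by changes of finitely many entries,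
then generically it is the same for two points of `A^ω`. -/
theorem eventually_range_eq_range_add {a : ℕ → A} (ha : a 0 = 0)
    (hS : Dense (AddSubgroup.closure (Set.range a) : Set A)) {f : (ℕ → A) → ℕ → Y}
    (hf : ∀ l, Measurable fun x => f x l)
    (hpert : ∀ x δ, Set.range (f x) = Set.range (f (x + perturb a δ)))
    (hfin : ∀ x y, (∀ᶠ n in atTop, x n = y n) → Set.range (f x) = Set.range (f y)) :
    ∀ᶠ p in residual ((ℕ → A) × (ℕ → A)), Set.range (f p.1) = Set.range (f (p.1 + p.2)) := by
  have hsub : ∀ᶠ p in residual ((ℕ → A) × (ℕ → A)),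
      Set.range (f p.1) ⊆ Set.range (f (p.1 + p.2)) := by
    simp only [Set.range_subset_iff]
    rw [eventually_countable_forall]
    intro l
    by_contra hc
    have hm : MeasurableSet {p : (ℕ → A) × (ℕ → A) | f p.1 l ∈ Set.range (f (p.1 + p.2))} := by
      simp only [Set.mem_range]
      rw [Set.ofPred_exists]
      exact .iUnion fun j => measurableSet_eq_fun
        ((hf j).comp (continuous_fst.add continuous_snd).measurable) ((hf l).comp measurable_fst)
    obtain ⟨O, hO, ⟨⟨x₀, η₀⟩, hp⟩, hOl⟩ := exists_isOpen_of_not_eventually_residual hm hc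
    obtain ⟨U', V', hU', hV', hx₀, hη₀, hUV⟩ := isOpen_prod_iff.1 hO x₀ η₀ hp
    obtain ⟨K, U, hUo, hUne, hUU', hU⟩ := exists_open_eventually_eq_add_tailFrom ha hS (hf l)
      (g := fun j x => f x j) hf (fun x δ => by
        have : f x l ∈ Set.range (f (x + perturb a δ)) := hpert x δ ▸ ⟨l, rfl⟩
        exact this.imp fun _ => Eq.symm) hU' ⟨x₀, hx₀⟩
    refine not_eventually_residual_notMem (hUo.prod hV') (hUne.prod ⟨η₀, hη₀⟩) ?_
    filter_upwards [hOl, hU] with p h1 h2 hpUV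
    refine h1 (hUV ⟨hUU' hpUV.1, hpUV.2⟩) ?_
    rw [h2 hpUV.1, hfin (p.1 + p.2) (p.1 + tailFrom K p.2)]
    · exact ⟨l, rfl⟩
    · filter_upwards [eventually_ge_atTop K] with n hn
      simp [tailFrom, hn]
  -- The reverse inclusion follows by the homeomorphism `(x, η) ↦ (x + η, -η)`.
  let Ψ := (shear (D := ℕ → A) id continuous_id).trans
    ((Homeomorph.refl (ℕ → A)).prodCongr (Homeomorph.neg (ℕ → A)))
  have hΨ := tendsto_residual_of_isOpenMap Ψ.continuous Ψ.isOpenMap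
  filter_upwards [hsub, hΨ.eventually hsub] with p h1 h2
  refine h1.antisymm ?_
  have : Set.range (f (p.1 + p.2)) ⊆ Set.range (f (p.1 + p.2 + -p.2)) := h2
  rwa [add_neg_cancel_right] at this

end Perturb

/-! ### `E_0^ω` is not reducible to `E_0` -/

section EZero

/-- The parities of an array of integers. -/
def parityBits (x : ℕ → ℕ → ℤ) (n i : ℕ) : Bool := decide (Odd (x n i))

theorem continuous_parityBits : Continuous parityBits :=
  continuous_pi fun n => continuous_pi fun i =>
    (continuous_of_discreteTopology (f := fun z : ℤ => decide (Odd z))).comp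
      ((continuous_apply i).comp (continuous_apply n))

/-- An enumeration of the zero sequence and the unit sequences. -/
def unitSeq : ℕ → ℕ → ℤ
  | 0 => 0
  | c + 1 => Pi.single c 1

theorem dense_closure_unitSeq :
    Dense (AddSubgroup.closure (Set.range unitSeq) : Set (ℕ → ℤ)) := by
  intro x
  refine mem_closure_of_tendsto (f := fun N : ℕ => ∑ i ∈ Finset.range N, Pi.single i (x i))
    (b := atTop) (tendsto_pi_nhds.2 fun i => ?_) (Eventually.of_forall fun N => ?_)
  · refine tendsto_const_nhds.congr' ?_
    filter_upwards [eventually_gt_atTop i] with N hN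
    rw [Finset.sum_apply, Finset.sum_pi_single]
    simp [hN]
  · refine sum_mem fun i _ => ?_
    have : (Pi.single i (x i) : ℕ → ℤ) = x i • unitSeq (i + 1) := by
      rw [unitSeq, ← Pi.single_smul, smul_eq_mul, mul_one]
    rw [this]
    exact zsmul_mem (AddSubgroup.subset_closure (Set.mem_range_self (i + 1))) _

theorem eZero_parityBits_add_perturb (x : ℕ → ℕ → ℤ) (δ : ℕ → ℕ) :
    omegaPower eZero (parityBits x) (parityBits (x + perturb unitSeq δ)) := by
  intro n
  rw [eZero_iff]
  filter_upwards [eventually_ge_atTop (δ n)] with i hi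
  have : unitSeq (δ n) i = 0 := by
    cases h : δ n with
    | zero => rfl
    | succ c =>
      rw [h] at hi
      rw [unitSeq, Pi.single_eq_of_ne (by omega)]
  simp [parityBits, perturb, this]

/-- A reduction would, by countability of the `E_0`-classes, be generically and locally invariant
under arbitrary changes of almost all rows, which do not preserve the class. -/
theorem not_omegaPower_eZero_reducible_eZero : ¬ BorelReducible (omegaPower eZero) eZero := by
  rintro ⟨θ, hθ, hred⟩
  have : PolishSpace Bool := {}
  rw [← BorelSpace.measurable_eq, ← BorelSpace.measurable_eq] at hθ
  have hf : Measurable fun x => θ (parityBits x) := hθ.comp continuous_parityBits.measurable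
  let g : ℕ → (ℕ → ℕ → ℤ) → ℕ → Bool := fun j x n =>
    ((Encodable.decode (α := List Bool) j).getD [])[n]?.getD (θ (parityBits x) n)
  have hg : ∀ j, Measurable (g j) := by
    intro j
    refine measurable_pi_lambda _ fun n => ?_
    change Measurable fun x => ((Encodable.decode (α := List Bool) j).getD [])[n]?.getD
      (θ (parityBits x) n)
    cases ((Encodable.decode (α := List Bool) j).getD [])[n]? with
    | none => exact (measurable_pi_apply n).comp hf
    | some b => exact measurable_const
  have h : ∀ x δ, ∃ j, θ (parityBits x) = g j (x + perturb unitSeq δ) := by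
    intro x δ
    obtain ⟨N, hN⟩ := eventually_atTop.1 <| eZero_iff.1 <|
      (hred _ _).1 (eZero_parityBits_add_perturb x δ)
    refine ⟨Encodable.encode (List.ofFn fun n : Fin N => θ (parityBits x) n), funext fun n => ?_⟩
    simp only [g, Encodable.encodek, Option.getD_some]
    by_cases hn : n < N
    · simp [hn]
    · simp [hn, hN n (not_lt.1 hn)]
  obtain ⟨K, U, hUo, hUne, -, hU⟩ := exists_open_eventually_eq_add_tailFrom (a := unitSeq) rfl
    dense_closure_unitSeq hf hg h isOpen_univ Set.univ_nonempty
  have hfreq : ∀ᶠ p in residual ((ℕ → ℕ → ℤ) × (ℕ → ℕ → ℤ)), ∃ᶠ i in atTop,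
      p ∈ {p : (ℕ → ℕ → ℤ) × (ℕ → ℕ → ℤ) | p.2 K i = 1} := by
    refine eventually_residual_frequently (fun i => ?_) fun p => ?_
    · exact (isOpen_discrete ({1} : Set ℤ)).preimage
        (f := fun p : (ℕ → ℕ → ℤ) × (ℕ → ℕ → ℤ) => p.2 K i) (by fun_prop)
    · refine ⟨fun i => (p.1, Function.update p.2 K (Function.update (p.2 K) i 1)),
        tendsto_const_nhds.prodMk_nhds (tendsto_pi_nhds.2 fun k => tendsto_pi_nhds.2 fun m => ?_),
        fun i => by simp⟩
      refine tendsto_const_nhds.congr' ?_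
      filter_upwards [eventually_gt_atTop m] with i hi
      by_cases hk : k = K
      · subst hk
        simp [hi.ne]
      · simp [hk]
  obtain ⟨p, ⟨h1, h2⟩, hpU⟩ := (dense_of_mem_residual (hU.and hfreq)).exists_mem_open
    (hUo.prod isOpen_univ) (hUne.prod Set.univ_nonempty)
  have heq : omegaPower eZero (parityBits p.1) (parityBits (p.1 + tailFrom K p.2)) :=
    (hred _ _).2 (by rw [h1 hpU.1])
  obtain ⟨i, hi1, hi2⟩ := (h2.and_eventually (eZero_iff.1 (heq K))).exists
  have hi1' : p.2 K i = 1 := hi1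
  simp [parityBits, tailFrom, hi1', ← Int.not_odd_iff_even] at hi2

end EZero

/-! ### A group whose `E(G)` reduces to `=^+` is non-archimedean -/

section Paths

variable {G : Type*} [Group G]

/-- The elements of the subgroup generated by a symmetric set `V` are reached from `1` by paths
with steps in `V`. Paths are indexed by `ℤ` so that they can be parametrised by a group. -/
theorem exists_path_of_mem_closure {V : Set G} (h1 : (1 : G) ∈ V) (hinv : V⁻¹ = V) {g : G}
    (hg : g ∈ Subgroup.closure V) :
    ∃ w : ℤ → G, w 0 = 1 ∧ (∀ i, w (i + 1) * (w i)⁻¹ ∈ V) ∧ ∃ m : ℕ, w m = g := by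
  have extend : ∀ v ∈ V, ∀ y : G,
      (∃ w : ℤ → G, w 0 = 1 ∧ (∀ i, w (i + 1) * (w i)⁻¹ ∈ V) ∧ ∃ m : ℕ, w m = y) →
      ∃ w : ℤ → G, w 0 = 1 ∧ (∀ i, w (i + 1) * (w i)⁻¹ ∈ V) ∧ ∃ m : ℕ, w m = v * y := by
    rintro v hv _ ⟨w, h0, hw, m, rfl⟩
    refine ⟨fun i => if i ≤ m then w i else v * w m, by simp [h0], fun i => ?_, m + 1, by simp⟩
    rcases lt_trichotomy i m with h | rfl | h
    · have h' : i + 1 ≤ m := h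
      simpa [h.le, h'] using hw i
    · simpa using hv
    · have h' : ¬ i + 1 ≤ m := by omega
      simpa [h.not_ge, h'] using h1
  induction hg using Subgroup.closure_induction_left with
  | one => exact ⟨fun _ => 1, rfl, by simpa using h1, 0, rfl⟩
  | mul_left v hv y _ ih => exact extend v hv y ih
  | inv_mul_cancel v hv y _ ih => exact extend v⁻¹ (by rwa [← hinv, Set.inv_mem_inv]) y ih

end Paths

section Turbulence

variable {G : Type*} [Group G] [TopologicalSpace G] [IsTopologicalGroup G]

/-- If `1` has a neighbourhood containing no open subgroup, then arbitrarily short steps lead from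
`1` out of some fixed neighbourhood. -/
theorem exists_paths_of_not_nonarchimedean [FirstCountableTopology G]
    (hG : ¬ NonarchimedeanGroup G) :
    ∃ U ∈ 𝓝 (1 : G), ∃ (q : ℕ → ℤ → G) (m : ℕ → ℤ), (∀ k, q k 0 = 1) ∧ (∀ k, q k (m k) ∉ U) ∧
      ∀ W ∈ 𝓝 (1 : G), ∀ᶠ k in atTop, ∀ i, q k (i + 1) * (q k i)⁻¹ ∈ W := by
  obtain ⟨U, hU, hno⟩ : ∃ U ∈ 𝓝 (1 : G), ∀ V : OpenSubgroup G, ¬ (V : Set G) ⊆ U := by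
    by_contra! h
    exact hG ⟨h⟩
  obtain ⟨B, hB⟩ := (𝓝 (1 : G)).exists_antitone_basis
  have hex : ∀ k, ∃ (w : ℤ → G) (m : ℤ), w 0 = 1 ∧ w m ∉ U ∧
      ∀ i, w (i + 1) * (w i)⁻¹ ∈ B k := by
    intro k
    set V : Set G := B k ∩ (B k)⁻¹ with hV
    have hVn : V ∈ 𝓝 (1 : G) := inter_mem (hB.mem k) (inv_mem_nhds_one G (hB.mem k))
    have hopen : IsOpen (Subgroup.closure V : Set G) :=
      Subgroup.isOpen_of_mem_nhds _ (g := 1) (mem_of_superset hVn Subgroup.subset_closure)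
    obtain ⟨g, hg, hgU⟩ := Set.not_subset.1 (hno ⟨Subgroup.closure V, hopen⟩)
    obtain ⟨w, h0, hw, m, rfl⟩ := exists_path_of_mem_closure (mem_of_mem_nhds hVn)
      (by rw [hV, Set.inter_inv, inv_inv, Set.inter_comm]) hg
    exact ⟨w, m, h0, hgU, fun i => (hw i).1⟩
  choose q m h0 hm hq using hex
  refine ⟨U, hU, q, m, h0, hm, fun W hW => ?_⟩
  obtain ⟨K, -, hK⟩ := hB.1.mem_iff.1 hW
  filter_upwards [eventually_ge_atTop K] with k hk i
  exact hK (hB.2 hk (hq k i))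

theorem nonarchimedeanGroup_of_inducedER_reducible_eqPlus [PolishSpace G]
    (h : BorelReducible (inducedER G) eqPlus) : NonarchimedeanGroup G := by
  by_contra hG
  obtain ⟨U, hU, q, m, h0, hm, hq⟩ := exists_paths_of_not_nonarchimedean hG
  obtain ⟨θ, hθ, hred⟩ := h
  -- A point `x ∈ ℤ^ω` selects a point on each path.
  let φ : (ℕ → ℤ) → ℕ → G := fun x => interleaveOne fun k => q k (x k)
  have hφ : Continuous φ := continuous_interleaveOne.comp <| continuous_pi fun k =>
    (continuous_of_discreteTopology (f := q k)).comp (continuous_apply k)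
  have hf : Measurable fun x => θ (φ x) := by
    have := @Measurable.comp _ _ _ (borel _) (borel _) (borel _) _ _ hθ hφ.borel_measurable
    rwa [← BorelSpace.measurable_eq, ← BorelSpace.measurable_eq] at this
  have hiff : ∀ x y, Set.range (θ (φ x)) = Set.range (θ (φ y)) ↔
      Tendsto (fun k => q k (x k) * (q k (y k))⁻¹) atTop (𝓝 1) := by
    intro x y
    rw [← eqPlus_iff, ← hred, inducedER_interleaveOne_iff]
  let a : ℕ → ℤ := fun c => if c = 0 then 0 else 1
  have hdense : Dense (AddSubgroup.closure (Set.range a) : Set ℤ) := by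
    have : AddSubgroup.closure (Set.range a) = ⊤ := by
      rw [eq_top_iff, ← Int.zmultiples_one, AddSubgroup.zmultiples_eq_closure]
      exact AddSubgroup.closure_mono (Set.singleton_subset_iff.2 ⟨1, rfl⟩)
    rw [this]
    exact dense_univ
  have hrange := eventually_range_eq_range_add (a := a) rfl hdense (f := fun x => θ (φ x))
    (fun l => (measurable_pi_apply l).comp hf)
    (fun x δ => by
      refine ((hiff _ _).2 (tendsto_def.2 fun W hW => ?_)).symm
      filter_upwards [hq W hW] with k hk
      by_cases hδ : δ k = 0
      · simpa [perturb, a, hδ] using mem_of_mem_nhds hW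
      · simpa [perturb, a, hδ] using hk (x k))
    (fun x y hxy => by
      refine (hiff _ _).2 (tendsto_const_nhds.congr' ?_)
      filter_upwards [hxy] with k hk
      rw [hk, mul_inv_cancel])
  have hfreq : ∀ᶠ p in residual ((ℕ → ℤ) × (ℕ → ℤ)), ∃ᶠ k in atTop,
      p ∈ {p : (ℕ → ℤ) × (ℕ → ℤ) | p.1 k = 0 ∧ p.2 k = m k} := by
    refine eventually_residual_frequently (fun k => ?_) fun p => ?_
    · exact ((isOpen_discrete ({0} : Set ℤ)).preimage
        ((continuous_apply (A := fun _ : ℕ => ℤ) k).comp continuous_fst)).inter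
        ((isOpen_discrete ({m k} : Set ℤ)).preimage
          ((continuous_apply (A := fun _ : ℕ => ℤ) k).comp continuous_snd))
    · have hup : ∀ (x y : ℕ → ℤ), Tendsto (fun k => Function.update x k (y k)) atTop (𝓝 x) := by
        intro x y
        refine tendsto_pi_nhds.2 fun i => tendsto_const_nhds.congr' ?_
        filter_upwards [eventually_gt_atTop i] with k hk
        rw [Function.update_of_ne hk.ne]
      exact ⟨fun k => (Function.update p.1 k 0, Function.update p.2 k (m k)),
        (hup p.1 0).prodMk_nhds (hup p.2 m), fun k => by simp⟩
  obtain ⟨p, hp1, hp2⟩ := (dense_of_mem_residual (hrange.and hfreq)).nonempty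
  have hlim := ((hiff _ _).1 hp1.symm).eventually_mem hU
  obtain ⟨k, ⟨hk1, hk2⟩, hk⟩ := (hp2.and_eventually hlim).exists
  refine hm k ?_
  simpa [hk1, hk2, h0] using hk

end Turbulence

/-! ### Discreteness -/

section Discrete

variable {G : Type*} [Group G] [TopologicalSpace G] [IsTopologicalGroup G]

theorem discreteTopology_of_countable [PolishSpace G] [Countable G] : DiscreteTopology G := by
  obtain ⟨g, hg⟩ := nonempty_interior_of_iUnion_of_closed (f := fun g : G => {g})
    (fun _ => isClosed_singleton) (Set.iUnion_of_singleton G)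
  have hopen : IsOpen ({g} : Set G) :=
    interior_eq_iff_isOpen.1 (interior_subset.antisymm (by
      obtain ⟨y, hy⟩ := hg
      obtain rfl := Set.mem_singleton_iff.1 (interior_subset hy)
      rwa [Set.singleton_subset_iff]))
  refine discreteTopology_of_isOpen_singleton_one ?_
  have := hopen.preimage (continuous_const_mul g)
  rwa [show (fun x => g * x) ⁻¹' {g} = {1} by ext x; simp] at this

theorem countable_discrete_nontrivial_of_bireducible [PolishSpace G]
    (h : BorelBireducible (inducedER G) eZero) :
    Countable G ∧ DiscreteTopology G ∧ Nontrivial G := by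
  have hc : Countable G := by
    by_contra hu
    have : Uncountable G := not_countable_iff.1 hu
    exact not_omegaPower_eZero_reducible_eZero
      (omegaPower_eZero_reducible_inducedER.trans h.1)
  refine ⟨hc, discreteTopology_of_countable, ?_⟩
  by_contra hs
  rw [not_nontrivial_iff_subsingleton] at hs
  obtain ⟨θ, -, hθ⟩ := h.2
  have : eZero (fun _ => true) (fun _ => false) := by
    rw [hθ, Subsingleton.elim (θ fun _ => true) (θ fun _ => false)]
  obtain ⟨n, hn⟩ := (eZero_iff.1 this).exists
  exact Bool.noConfusion hn

end Discrete

end PolishER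

theorem theorem1p1 (G : Type*) [Group G] [TopologicalSpace G] [IsTopologicalGroup G]
    [PolishSpace G] :
    ((Countable G ∧ DiscreteTopology G ∧ Nontrivial G) ↔
      PolishER.BorelBireducible (PolishER.inducedER G) PolishER.eZero) ∧
    (PolishER.IsTSI G → Uncountable G → NonarchimedeanGroup G →
      PolishER.BorelBireducible (PolishER.inducedER G)
        (PolishER.omegaPower PolishER.eZero)) ∧
    (NonarchimedeanGroup G ↔
      PolishER.BorelReducible (PolishER.inducedER G) PolishER.eqPlus) ∧
    (Uncountable G →
      PolishER.BorelReducible (PolishER.omegaPower PolishER.eZero)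
        (PolishER.inducedER G)) := by
  refine ⟨⟨?_, PolishER.countable_discrete_nontrivial_of_bireducible⟩, ?_,
    ⟨fun _ => PolishER.inducedER_reducible_eqPlus,
      PolishER.nonarchimedeanGroup_of_inducedER_reducible_eqPlus⟩,
    fun _ => PolishER.omegaPower_eZero_reducible_inducedER⟩
  · rintro ⟨_, _, _⟩
    exact ⟨PolishER.inducedER_reducible_eZero, PolishER.eZero_reducible_inducedER⟩
  · intro hT _ _
    exact ⟨PolishER.inducedER_reducible_omegaPower_eZero hT,
      PolishER.omegaPower_eZero_reducible_inducedER⟩
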